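/- **Proposition (Geometry of $\mathcal Z$).** Let $m,n\ge 0$ be integers, let $\boldsymbol S^n$ be the space of real symmetric $n\times n$ matrices and $\boldsymbol S^n_{++}\subset\boldsymbol S^n$ the set of positive definite ones. For $\Sigma\in\boldsymbol S^n_{++}$ and $V\in\boldsymbol S^n$ let $\mathbf L_\Sigma[V]$ denote the unique $H\in\boldsymbol S^n$ with $H\Sigma+\Sigma H=V$. Let $\mathcal Z=\mathbb R^m\times\mathbb R^n\times\boldsymbol S^n_{++}$, a smooth manifold as an open subset of the vector space $\mathbb R^m\times\mathbb R^n\times\boldsymbol S^n$. Then: 1. At each point $z=(x,\mu,\Sigma)\in\mathcal Z$ the tangent space is $T_z\mathcal Z=\mathbb R^m\times\mathbb R^n\times\boldsymbol S^n$ (the identification being the differential of the inclusion of $\mathcal Z$), and $$\big\langle (w_1,v_1,V_1),(w_2,v_2,V_2)\big\rangle_z=\langle w_1,w_2\rangle+\langle v_1,v_2\rangle+\operatorname{tr}\big(\mathbf L_\Sigma[V_1]\,\Sigma\,\mathbf L_\Sigma[V_2]\big)$$ defines a smooth ($C^\infty$) Riemannian metric on $\mathcal Z$. 2. The Riemannian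 distance of this metric, i.e. the infimum of the lengths of $C^1$ paths in $\mathcal Z$ joining two points, is $$d\big((x_1,\mu_1,\Sigma_1),(x_2,\mu_2,\Sigma_2)\big)=\big[\|x_1-x_2\|_2^2+\|\mu_1-\mu_2\|_2^2+\mathbb B(\Sigma_1,\Sigma_2)^2\big]^{1/2},$$ where $\mathbb B(\Sigma_1,\Sigma_2)=\big[\operatorname{tr}\big(\Sigma_1+\Sigma_2-2(\Sigma_1^{1/2}\Sigma_2\Sigma_1^{1/2})^{1/2}\big)\big]^{1/2}$ is the Bures metric on $\boldsymbol S^n_{++}$. -/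

import Mathlib

open Bundle Manifold
open scoped MatrixOrder ContDiff Matrix

namespace FeatureGaussian

/-- The subspace of symmetric matrices in the space of real `n × n` matrices. -/
def Sym (n : ℕ) : Submodule ℝ (Matrix (Fin n) (Fin n) ℝ) where
  carrier := {A | A.IsSymm}
  add_mem' hA hB := hA.add hB
  zero_mem' := Matrix.isSymm_zero
  smul_mem' c _ hA := hA.smul c

/-- The space `S^n` as a normed space. -/
def SymMat (n : ℕ) : Type := ↥(Sym n)

/-- `S^n` is normed by the largest absolute value of an entry. As `S^n` is finite dimensional, its
topology and its smooth structure do not depend on this choice. -/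
noncomputable instance instNormedAddCommGroupSymMat (n : ℕ) : NormedAddCommGroup (SymMat n) :=
  letI : NormedAddCommGroup (Matrix (Fin n) (Fin n) ℝ) := Matrix.normedAddCommGroup
  Submodule.normedAddCommGroup (Sym n)

noncomputable instance instNormedSpaceSymMat (n : ℕ) : NormedSpace ℝ (SymMat n) :=
  letI : NormedAddCommGroup (Matrix (Fin n) (Fin n) ℝ) := Matrix.normedAddCommGroup
  letI : NormedSpace ℝ (Matrix (Fin n) (Fin n) ℝ) := Matrix.normedSpace
  Submodule.normedSpace (Sym n)

instance instFiniteDimensionalSymMat (n : ℕ) : FiniteDimensional ℝ (SymMat n) :=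
  inferInstanceAs (FiniteDimensional ℝ (Sym n))

/-- The matrix underlying an element of `S^n`. -/
def SymMat.mat {n : ℕ} (A : SymMat n) : Matrix (Fin n) (Fin n) ℝ := A.1

/-- The vector space `ℝ^m × ℝ^n × S^n`. -/
abbrev Model (m n : ℕ) : Type :=
  EuclideanSpace ℝ (Fin m) × EuclideanSpace ℝ (Fin n) × SymMat n

theorem continuous_coe_sym (n : ℕ) :
    Continuous (fun A : SymMat n => A.mat) :=
  continuous_subtype_val

/-- The positive definite matrices form an open subset of the symmetric ones. -/
theorem isOpen_posDef (n : ℕ) :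
    IsOpen {A : SymMat n | A.mat.PosDef} := by
  have h : {A : SymMat n | A.mat.PosDef} =
      {A : SymMat n | ∀ x ∈ Metric.sphere (0 : Fin n → ℝ) 1,
        0 < x ⬝ᵥ (A.mat *ᵥ x)} := by
    ext A
    have hA : A.mat.IsHermitian := by
      rw [Matrix.IsHermitian, Matrix.conjTranspose_eq_transpose_of_trivial]
      exact A.2
    simp only [Set.mem_ofPred_eq]
    rw [Matrix.posDef_iff_dotProduct_mulVec]
    constructor
    · rintro ⟨-, hp⟩ x hx
      have hx0 : x ≠ 0 := by
        rintro rfl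
        simp at hx
      simpa using hp hx0
    · intro hp
      refine ⟨hA, fun x hx => ?_⟩
      have hn : 0 < ‖x‖ := norm_pos_iff.mpr hx
      have h1 := hp (‖x‖⁻¹ • x) (by simp [norm_smul, hn.ne'])
      rw [Matrix.mulVec_smul, smul_dotProduct, dotProduct_smul, smul_eq_mul, smul_eq_mul] at h1
      have h2 := pos_of_mul_pos_right (pos_of_mul_pos_right h1 (by positivity)) (by positivity)
      simpa using h2
  rw [h]
  have hc : Continuous (fun p : SymMat n × (Fin n → ℝ) =>
      p.2 ⬝ᵥ (p.1.mat *ᵥ p.2)) :=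
    continuous_snd.dotProduct
      (((continuous_coe_sym n).comp continuous_fst).matrix_mulVec continuous_snd)
  rw [isOpen_iff_mem_nhds]
  intro A hA
  exact (isCompact_sphere (0 : Fin n → ℝ) 1).eventually_forall_of_forall_eventually
    (fun x hx => hc.continuousAt.eventually (lt_mem_nhds (hA x hx)))

/-- The feature-Gaussian space `Z = ℝ^m × ℝ^n × S^n_{++}`, an open subset of `ℝ^m × ℝ^n × S^n`,
with the manifold structure of an open subset of a vector space. -/
def Z (m n : ℕ) : TopologicalSpace.Opens (Model m n) where
  carrier := {z | z.2.2.mat.PosDef}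
  is_open' := (isOpen_posDef n).preimage (continuous_snd.comp continuous_snd)

/-- The Lyapunov operator `H ↦ H Σ + Σ H` on symmetric matrices. -/
def lyapunovMap {n : ℕ} (S : SymMat n) : SymMat n →ₗ[ℝ] SymMat n where
  toFun H := ⟨H.mat * S.mat + S.mat * H.mat, by
    have hS : S.matᵀ = S.mat := S.2
    have hH : H.matᵀ = H.mat := H.2
    change (H.mat * S.mat + S.mat * H.mat)ᵀ = H.mat * S.mat + S.mat * H.mat
    rw [Matrix.transpose_add, Matrix.transpose_mul, Matrix.transpose_mul, hS, hH, add_comm]⟩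
  map_add' H K := by
    refine Subtype.ext ?_
    change (H.mat + K.mat) * S.mat + S.mat * (H.mat + K.mat) =
      (H.mat * S.mat + S.mat * H.mat) + (K.mat * S.mat + S.mat * K.mat)
    rw [add_mul, mul_add]
    abel
  map_smul' c H := by
    refine Subtype.ext ?_
    change (c • H.mat) * S.mat + S.mat * (c • H.mat) = c • (H.mat * S.mat + S.mat * H.mat)
    simp

theorem lyapunovMap_injective {n : ℕ} (S : SymMat n)
    (hS : S.mat.PosDef) : Function.Injective (lyapunovMap S) := by
  rw [← LinearMap.ker_eq_bot, LinearMap.ker_eq_bot']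
  intro H hH
  have h0 : H.mat * S.mat + S.mat * H.mat = 0 :=
    congrArg Subtype.val hH
  have hHt : H.matᴴ = H.mat := by
    rw [Matrix.conjTranspose_eq_transpose_of_trivial]
    exact H.2
  set A : Matrix (Fin n) (Fin n) ℝ := H.mat
  set B : Matrix (Fin n) (Fin n) ℝ := S.mat
  have h1 : (A * B * A).trace = 0 := by
    have h2 : ((A * B + B * A) * A).trace = 0 := by rw [h0]; simp
    rw [add_mul, Matrix.trace_add] at h2
    have h3 : (B * A * A).trace = (A * B * A).trace := by
      rw [Matrix.trace_mul_comm (B * A) A, mul_assoc]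
    linarith
  have hpsd : (A * B * A).PosSemidef := by
    have := hS.posSemidef.mul_mul_conjTranspose_same A
    rwa [hHt] at this
  have hz : A * B * A = 0 := hpsd.trace_eq_zero_iff.mp h1
  have hA : A = 0 := by
    ext i j
    by_contra hij
    have hv : A *ᵥ (Pi.single j 1) ≠ 0 := by
      intro h
      apply hij
      have := congrFun h i
      simpa using this
    have hp := (Matrix.posDef_iff_dotProduct_mulVec.mp hS).2 hv
    rw [Matrix.star_mulVec, hHt, ← Matrix.dotProduct_mulVec, Matrix.mulVec_mulVec,
      Matrix.mulVec_mulVec, hz] at hp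
    simp at hp
  exact Subtype.ext hA

/-- `L_Σ[V]`, for `Σ` positive definite: the unique symmetric solution `H` of the Lyapunov
equation `H Σ + Σ H = V`. -/
noncomputable def lyapunov {n : ℕ} (S : SymMat n) (hS : S.mat.PosDef)
    (V : SymMat n) : SymMat n :=
  (LinearEquiv.ofInjectiveEndo (lyapunovMap S) (lyapunovMap_injective S hS)).symm V

/-- `⟨V₁, V₂⟩_Σ = tr (L_Σ[V₁] Σ L_Σ[V₂])`. -/
noncomputable def spdInner {n : ℕ} (S : SymMat n) (hS : S.mat.PosDef)
    (V₁ V₂ : SymMat n) : ℝ :=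
  ((lyapunov S hS V₁).mat * S.mat *
    (lyapunov S hS V₂).mat).trace

/-- The bilinear form
`⟨(w₁, v₁, V₁), (w₂, v₂, V₂)⟩_z = ⟨w₁, w₂⟩ + ⟨v₁, v₂⟩ + tr (L_Σ[V₁] Σ L_Σ[V₂])`. -/
noncomputable def zInner {m n : ℕ} (z : Z m n) (u₁ u₂ : Model m n) : ℝ :=
  inner ℝ u₁.1 u₂.1 + inner ℝ u₁.2.1 u₂.2.1 + spdInner z.1.2.2 z.2 u₁.2.2 u₂.2.2

/-- The Bures distance `[tr (Σ₁ + Σ₂ - 2 (Σ₁^{1/2} Σ₂ Σ₁^{1/2})^{1/2})]^{1/2}`; here `CFC.sqrt` is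
the positive semidefinite square root. -/
noncomputable def bures {n : ℕ} (A B : Matrix (Fin n) (Fin n) ℝ) : ℝ :=
  √((A + B - (2 : ℝ) • CFC.sqrt (CFC.sqrt A * B * CFC.sqrt A)).trace)

/-- The distance `d` on `Z`. -/
noncomputable def zDist {m n : ℕ} (z₁ z₂ : Z m n) : ℝ :=
  √(‖z₁.1.1 - z₂.1.1‖ ^ 2 + ‖z₁.1.2.1 - z₂.1.2.1‖ ^ 2 +
    bures z₁.1.2.2.mat z₂.1.2.2.mat ^ 2)

end FeatureGaussian

/-! The Bures distance is the quotient of the Frobenius distance under `X ↦ X * Xᵀ`: whatever factor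
`X` of `A` is fixed, `bures A B` is the least `‖X - Y‖` over the factors `Y` of `B`, attained at `Y
= T * X` for the positive definite `T` with `T * A * T = B`. The triangle inequality follows by
lifting.

The metric is smooth because the Lyapunov operator is linear in `Σ` and operator inversion is
smooth. Since `Z` is open in a vector space, its charts are the inclusion, and bundle statements
reduce to statements about the form `zForm`.

Distance at most `zDist`: with `D = T - 1`, the curve `(1 + t D) Σ₁ (1 + t D)` has velocity whose
Lyapunov preimage is `(1 + t D)⁻¹ D`, so its squared speed is the constant `tr (D Σ₁ D) = bures Σ₁
Σ₂ ^ 2`; line segments serve the other factors (`spdInner_displacement`).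

Distance at least `zDist`: as `zDist` satisfies the triangle inequality, it suffices that it is
infinitesimally bounded by the Riemannian norm. Any symmetric `T` with `T Σ T = B` bounds the Bures
distance (`bures_sq_le`), and the inverse function theorem supplies such `T` near the identity, so
no matrix square root is differentiated. A comparison theorem for right slopes integrates the bound
along a path (`zDist_le_integral`). -/

namespace FeatureGaussian

/-! ### Bures distance as a quotient of the Frobenius distance -/

section BuresMatrix

open scoped Matrix.Norms.Frobenius

variable {n : ℕ}

theorem frobenius_norm_sq (A : Matrix (Fin n) (Fin n) ℝ) : ‖A‖ ^ 2 = (Aᵀ * A).trace := by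
  rw [Matrix.frobenius_norm_def, ← Real.sqrt_eq_rpow, Real.sq_sqrt (by positivity),
    Matrix.trace, Finset.sum_comm]
  simp [Matrix.mul_apply, sq]

theorem posDef_sqrt {A : Matrix (Fin n) (Fin n) ℝ} (hA : A.PosDef) : (CFC.sqrt A).PosDef :=
  Matrix.isStrictlyPositive_iff_posDef.mp
    ((Matrix.isStrictlyPositive_iff_posDef.mpr hA).sqrt)

theorem sqrt_mul_sqrt_of_posDef {A : Matrix (Fin n) (Fin n) ℝ} (hA : A.PosDef) :
    CFC.sqrt A * CFC.sqrt A = A :=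
  CFC.sqrt_mul_sqrt_self A hA.posSemidef.nonneg

theorem transpose_eq_of_posDef {A : Matrix (Fin n) (Fin n) ℝ} (hA : A.PosDef) : Aᵀ = A := by
  rw [← Matrix.conjTranspose_eq_transpose_of_trivial]
  exact hA.isHermitian

theorem posDef_mul_mul {A R : Matrix (Fin n) (Fin n) ℝ} (hA : A.PosDef) (hR : R.PosDef) :
    (R * A * R).PosDef := by
  have := hA.mul_mul_conjTranspose_same (B := R)
    (Matrix.vecMul_injective_of_isUnit hR.isUnit)
  rwa [hR.isHermitian.eq] at this

/-- The optimal transport map between two centred nondegenerate Gaussians. -/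
theorem exists_transport {A B : Matrix (Fin n) (Fin n) ℝ} (hA : A.PosDef) (hB : B.PosDef) :
    ∃ T : Matrix (Fin n) (Fin n) ℝ, T.PosDef ∧ T * A * T = B ∧
      (T * A).trace = (CFC.sqrt (CFC.sqrt A * B * CFC.sqrt A)).trace := by
  have hR := posDef_sqrt hA
  have hRR := sqrt_mul_sqrt_of_posDef hA
  set R := CFC.sqrt A
  have hC := posDef_mul_mul hB hR
  have hQ := posDef_sqrt hC
  have hQQ := sqrt_mul_sqrt_of_posDef hC
  set Q := CFC.sqrt (R * B * R)
  have h1 : R⁻¹ * R = 1 := Matrix.nonsing_inv_mul _ ((Matrix.isUnit_iff_isUnit_det R).mp hR.isUnit)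
  have h2 : R * R⁻¹ = 1 := Matrix.mul_nonsing_inv _ ((Matrix.isUnit_iff_isUnit_det R).mp hR.isUnit)
  -- With `A = R * R`, the equation `T * A * T = B` gives `(R * T * R) ^ 2 = R * B * R`, whose
  -- positive root is `R * T * R = Q`.
  refine ⟨R⁻¹ * Q * R⁻¹, posDef_mul_mul hQ hR.inv, ?_, ?_⟩
  · calc R⁻¹ * Q * R⁻¹ * A * (R⁻¹ * Q * R⁻¹)
        = R⁻¹ * Q * (R⁻¹ * R) * (R * R⁻¹) * Q * R⁻¹ := by rw [← hRR]; noncomm_ring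
      _ = R⁻¹ * (Q * Q) * R⁻¹ := by rw [h1, h2]; noncomm_ring
      _ = (R⁻¹ * R) * B * (R * R⁻¹) := by rw [hQQ]; noncomm_ring
      _ = B := by rw [h1, h2]; noncomm_ring
  · calc (R⁻¹ * Q * R⁻¹ * A).trace
        = (R⁻¹ * Q * (R⁻¹ * R) * R).trace := by rw [← hRR]; congr 1; noncomm_ring
      _ = (R * R⁻¹ * Q).trace := by
          rw [h1, mul_one, Matrix.trace_mul_comm, mul_assoc]
      _ = Q.trace := by rw [h2, one_mul]

theorem frobenius_norm_sub_sq (X Y : Matrix (Fin n) (Fin n) ℝ) :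
    ‖X - Y‖ ^ 2 = (X * Xᵀ).trace + (Y * Yᵀ).trace - 2 * (Xᵀ * Y).trace := by
  have h : (Yᵀ * X).trace = (Xᵀ * Y).trace := by
    rw [← Matrix.trace_transpose, Matrix.transpose_mul, Matrix.transpose_transpose]
  rw [frobenius_norm_sq, Matrix.transpose_sub, sub_mul, mul_sub, mul_sub, Matrix.trace_sub,
    Matrix.trace_sub, Matrix.trace_sub, h, Matrix.trace_mul_comm X, Matrix.trace_mul_comm Y]
  ring

theorem frobenius_norm_sub_mul_sq {X T A B : Matrix (Fin n) (Fin n) ℝ} (hX : X * Xᵀ = A)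
    (hT : Tᵀ = T) (hB : T * A * T = B) :
    ‖X - T * X‖ ^ 2 = A.trace + B.trace - 2 * (T * A).trace := by
  have h1 : T * X * (T * X)ᵀ = B := by
    rw [Matrix.transpose_mul, hT, ← hB, ← hX]; noncomm_ring
  have h2 : (Xᵀ * (T * X)).trace = (T * A).trace := by
    rw [Matrix.trace_mul_comm, mul_assoc, hX]
  rw [frobenius_norm_sub_sq, h1, h2, hX]

/-- A weighted Young inequality: expanding the `T`-weighted square of `X - T⁻¹ * Y` gives `2 tr (Xᵀ
Y) ≤ tr (T A) + tr (T⁻¹ B)`, and the two traces on the right agree. -/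
theorem trace_transpose_mul_le {A B X Y T : Matrix (Fin n) (Fin n) ℝ} (hT : T.PosDef)
    (hB : T * A * T = B) (hX : X * Xᵀ = A) (hY : Y * Yᵀ = B) :
    (Xᵀ * Y).trace ≤ (T * A).trace := by
  have hu := (Matrix.isUnit_iff_isUnit_det T).mp hT.isUnit
  have h1 : T⁻¹ * T = 1 := Matrix.nonsing_inv_mul _ hu
  have h2 : T * T⁻¹ = 1 := Matrix.mul_nonsing_inv _ hu
  have hti : T⁻¹ᵀ = T⁻¹ := transpose_eq_of_posDef hT.inv
  have hp : 0 ≤ ((X - T⁻¹ * Y)ᵀ * T * (X - T⁻¹ * Y)).trace := by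
    have := (hT.posSemidef.conjTranspose_mul_mul_same (X - T⁻¹ * Y)).trace_nonneg
    rwa [Matrix.conjTranspose_eq_transpose_of_trivial] at this
  have he : (X - T⁻¹ * Y)ᵀ * T * (X - T⁻¹ * Y) =
      Xᵀ * T * X - Xᵀ * Y - Yᵀ * X + Yᵀ * (T⁻¹ * Y) := by
    rw [Matrix.transpose_sub, Matrix.transpose_mul, hti]
    calc _ = Xᵀ * T * X - Xᵀ * (T * T⁻¹) * Y - Yᵀ * (T⁻¹ * T) * X
          + Yᵀ * (T⁻¹ * T) * (T⁻¹ * Y) := by noncomm_ring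
      _ = _ := by rw [h1, h2]; noncomm_ring
  have h3 : (Yᵀ * X).trace = (Xᵀ * Y).trace := by
    rw [← Matrix.trace_transpose, Matrix.transpose_mul, Matrix.transpose_transpose]
  have h4 : (Xᵀ * T * X).trace = (T * A).trace := by
    rw [mul_assoc, Matrix.trace_mul_comm, mul_assoc, hX]
  have h5 : (Yᵀ * (T⁻¹ * Y)).trace = (T * A).trace := by
    rw [Matrix.trace_mul_comm, mul_assoc, hY, ← hB]
    calc (T⁻¹ * (T * A * T)).trace = (T⁻¹ * T * (A * T)).trace := by congr 1; noncomm_ring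
      _ = _ := by rw [h1, one_mul, Matrix.trace_mul_comm]
  rw [he, Matrix.trace_add, Matrix.trace_sub, Matrix.trace_sub, h3, h4, h5] at hp
  linarith

theorem bures_eq_sqrt (A B : Matrix (Fin n) (Fin n) ℝ) : bures A B =
    √(A.trace + B.trace - 2 * (CFC.sqrt (CFC.sqrt A * B * CFC.sqrt A)).trace) := by
  rw [bures, Matrix.trace_sub, Matrix.trace_add, Matrix.trace_smul, smul_eq_mul]

theorem bures_eq_of_transport {A B X T : Matrix (Fin n) (Fin n) ℝ}
    (hX : X * Xᵀ = A) (hT : T.PosDef) (hB : T * A * T = B)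
    (htr : (T * A).trace = (CFC.sqrt (CFC.sqrt A * B * CFC.sqrt A)).trace) :
    bures A B = ‖X - T * X‖ := by
  rw [bures_eq_sqrt, ← htr, ← frobenius_norm_sub_mul_sq hX (transpose_eq_of_posDef hT) hB,
    Real.sqrt_sq (norm_nonneg _)]

theorem bures_le {A B X Y : Matrix (Fin n) (Fin n) ℝ} (hA : A.PosDef) (hB : B.PosDef)
    (hX : X * Xᵀ = A) (hY : Y * Yᵀ = B) : bures A B ≤ ‖X - Y‖ := by
  obtain ⟨T, hT, hTB, htr⟩ := exists_transport hA hB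
  refine Real.sqrt_le_iff.mpr ⟨norm_nonneg _, ?_⟩
  have := trace_transpose_mul_le hT hTB hX hY
  rw [frobenius_norm_sub_sq, hX, hY, Matrix.trace_sub, Matrix.trace_add, Matrix.trace_smul,
    smul_eq_mul, ← htr]
  linarith

/-- The factor `X` is prescribed; this freedom is what lets consecutive optimal pairs be chained in
`bures_triangle`. -/
theorem exists_bures_eq {A B X : Matrix (Fin n) (Fin n) ℝ} (hA : A.PosDef) (hB : B.PosDef)
    (hX : X * Xᵀ = A) : ∃ Y : Matrix (Fin n) (Fin n) ℝ, Y * Yᵀ = B ∧ bures A B = ‖X - Y‖ := by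
  obtain ⟨T, hT, hTB, htr⟩ := exists_transport hA hB
  refine ⟨T * X, ?_, bures_eq_of_transport hX hT hTB htr⟩
  rw [Matrix.transpose_mul, transpose_eq_of_posDef hT, ← hTB, ← hX]
  noncomm_ring

theorem exists_mul_transpose_eq {A : Matrix (Fin n) (Fin n) ℝ} (hA : A.PosDef) :
    ∃ X : Matrix (Fin n) (Fin n) ℝ, X * Xᵀ = A :=
  ⟨CFC.sqrt A, by rw [transpose_eq_of_posDef (posDef_sqrt hA), sqrt_mul_sqrt_of_posDef hA]⟩

theorem bures_triangle {A B C : Matrix (Fin n) (Fin n) ℝ} (hA : A.PosDef) (hB : B.PosDef)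
    (hC : C.PosDef) : bures A C ≤ bures A B + bures B C := by
  obtain ⟨X, hX⟩ := exists_mul_transpose_eq hA
  obtain ⟨Y, hY, hXY⟩ := exists_bures_eq hA hB hX
  obtain ⟨W, hW, hYW⟩ := exists_bures_eq hB hC hY
  rw [hXY, hYW]
  exact (bures_le hA hC hX hW).trans (norm_sub_le_norm_sub_add_norm_sub X Y W)

theorem bures_comm {A B : Matrix (Fin n) (Fin n) ℝ} (hA : A.PosDef) (hB : B.PosDef) :
    bures A B = bures B A := by
  have key : ∀ {A B : Matrix (Fin n) (Fin n) ℝ}, A.PosDef → B.PosDef →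
      bures A B ≤ bures B A := by
    intro A B hA hB
    obtain ⟨Y, hY⟩ := exists_mul_transpose_eq hB
    obtain ⟨X, hX, h⟩ := exists_bures_eq hB hA hY
    rw [h, norm_sub_rev]
    exact bures_le hA hB hX hY
  exact le_antisymm (key hA hB) (key hB hA)

theorem bures_nonneg (A B : Matrix (Fin n) (Fin n) ℝ) : 0 ≤ bures A B := Real.sqrt_nonneg _

/-- Any symmetric, not necessarily optimal, transport map bounds the Bures distance. -/
theorem bures_sq_le {A B T : Matrix (Fin n) (Fin n) ℝ} (hA : A.PosDef) (hB : B.PosDef)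
    (hT : Tᵀ = T) (hTB : T * A * T = B) :
    bures A B ^ 2 ≤ ((T - 1) * A * (T - 1)).trace := by
  obtain ⟨X, hX⟩ := exists_mul_transpose_eq hA
  have hY : T * X * (T * X)ᵀ = B := by
    rw [Matrix.transpose_mul, hT, ← hTB, ← hX]; noncomm_ring
  have h1 : ((T - 1) * A * (T - 1)).trace = ‖X - T * X‖ ^ 2 := by
    have : (T - 1) * A * (T - 1) = T * A * T - T * A - A * T + A := by noncomm_ring
    rw [frobenius_norm_sub_mul_sq hX hT hTB, this, hTB, Matrix.trace_add, Matrix.trace_sub,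
      Matrix.trace_sub, Matrix.trace_mul_comm A T]
    ring
  rw [h1]
  exact pow_le_pow_left₀ (bures_nonneg _ _) (bures_le hA hB hX hY) 2

end BuresMatrix

/-- There is a symmetric positive definite transport map realizing the Bures distance. -/
theorem exists_transport_bures {n : ℕ} {A B : Matrix (Fin n) (Fin n) ℝ} (hA : A.PosDef)
    (hB : B.PosDef) : ∃ T : Matrix (Fin n) (Fin n) ℝ, T.PosDef ∧ T * A * T = B ∧
      ((T - 1) * A * (T - 1)).trace = bures A B ^ 2 := by
  obtain ⟨T, hT, hTB, htr⟩ := exists_transport hA hB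
  -- Needed only to know that the radicand of `bures A B` is nonnegative.
  have hle := bures_sq_le hA hB (transpose_eq_of_posDef hT) hTB
  refine ⟨T, hT, hTB, ?_⟩
  have h : (T - 1) * A * (T - 1) = T * A * T - T * A - A * T + A := by noncomm_ring
  have h' : ((T - 1) * A * (T - 1)).trace = A.trace + B.trace - 2 * (T * A).trace := by
    rw [h, hTB, Matrix.trace_add, Matrix.trace_sub, Matrix.trace_sub, Matrix.trace_mul_comm A T]
    ring
  rw [bures_eq_sqrt, ← htr, ← h', Real.sq_sqrt ((sq_nonneg _).trans hle)]

/-! ### Smoothness and positivity of the covariance metric -/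

section Metric

variable {n : ℕ}

theorem mat_add (A B : SymMat n) : (A + B).mat = A.mat + B.mat := rfl

theorem mat_smul (c : ℝ) (A : SymMat n) : (c • A).mat = c • A.mat := rfl

theorem mat_zero : (0 : SymMat n).mat = 0 := rfl

theorem mat_transpose (A : SymMat n) : A.matᵀ = A.mat := A.2

theorem mat_injective : Function.Injective (SymMat.mat : SymMat n → _) := Subtype.val_injective

theorem mat_lyapunovMap (S H : SymMat n) :
    (lyapunovMap S H).mat = H.mat * S.mat + S.mat * H.mat := rfl

theorem lyapunovMap_lyapunov (S : SymMat n) (hS : S.mat.PosDef) (V : SymMat n) :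
    lyapunovMap S (lyapunov S hS V) = V :=
  (LinearEquiv.ofInjectiveEndo (lyapunovMap S) (lyapunovMap_injective S hS)).apply_symm_apply V

theorem lyapunov_lyapunovMap (S : SymMat n) (hS : S.mat.PosDef) (H : SymMat n) :
    lyapunov S hS (lyapunovMap S H) = H :=
  (LinearEquiv.ofInjectiveEndo (lyapunovMap S) (lyapunovMap_injective S hS)).symm_apply_apply H

/-- The Lyapunov operator as a bounded operator depending linearly on `S`. -/
noncomputable def lyapunovCLM (n : ℕ) : SymMat n →L[ℝ] SymMat n →L[ℝ] SymMat n :=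
  LinearMap.toContinuousBilinearMap
    { toFun := lyapunovMap
      map_add' := fun A B => LinearMap.ext fun H => mat_injective <| by
        simp only [LinearMap.add_apply, mat_add, mat_lyapunovMap]; noncomm_ring
      map_smul' := fun c A => LinearMap.ext fun H => mat_injective <| by
        simp [mat_smul, mat_lyapunovMap] }

theorem lyapunovCLM_apply (S H : SymMat n) : lyapunovCLM n S H = lyapunovMap S H := rfl

/-- The Lyapunov operator of a positive definite matrix as a continuous linear equivalence. -/
noncomputable def lyapunovEquiv (S : SymMat n) (hS : S.mat.PosDef) : SymMat n ≃L[ℝ] SymMat n :=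
  (LinearEquiv.ofInjectiveEndo (lyapunovMap S) (lyapunovMap_injective S hS)).toContinuousLinearEquiv

theorem coe_lyapunovEquiv (S : SymMat n) (hS : S.mat.PosDef) :
    (lyapunovEquiv S hS : SymMat n →L[ℝ] SymMat n) = lyapunovCLM n S := rfl

/-- The pairing `(H, V) ↦ tr (H V) / 2`. -/
noncomputable def tracePairing (n : ℕ) : SymMat n →L[ℝ] SymMat n →L[ℝ] ℝ :=
  LinearMap.toContinuousBilinearMap
    (LinearMap.mk₂ ℝ (fun H V => (1 / 2 : ℝ) * (H.mat * V.mat).trace)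
      (fun A B C => by rw [mat_add, add_mul, Matrix.trace_add, mul_add])
      (fun c A B => by simp [mat_smul]; ring)
      (fun A B C => by rw [mat_add, mul_add, Matrix.trace_add, mul_add])
      (fun c A B => by simp [mat_smul]; ring))

theorem tracePairing_apply (H V : SymMat n) :
    tracePairing n H V = (1 / 2 : ℝ) * (H.mat * V.mat).trace := rfl

/-- By transposition and cyclicity both terms of `K S + S K` contribute equally. Hence `tr (L[V] S
L[W]) = tr (L[V] W) / 2`, which involves only one Lyapunov inverse. -/
theorem tracePairing_lyapunovMap (S H K : SymMat n) :
    tracePairing n H (lyapunovMap S K) = (H.mat * S.mat * K.mat).trace := by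
  have h : (H.mat * (K.mat * S.mat)).trace = (H.mat * S.mat * K.mat).trace := by
    rw [← Matrix.trace_transpose, Matrix.transpose_mul, Matrix.transpose_mul, mat_transpose,
      mat_transpose, mat_transpose, Matrix.trace_mul_comm, mul_assoc]
  rw [tracePairing_apply, mat_lyapunovMap, mul_add, Matrix.trace_add, h, mul_assoc]
  ring

/-- The bilinear form `(V₁, V₂) ↦ tr (L_S[V₁] S L_S[V₂])` for `S` positive definite. -/
noncomputable def spdForm (S : SymMat n) : SymMat n →L[ℝ] SymMat n →L[ℝ] ℝ :=
  tracePairing n ∘SL ContinuousLinearMap.inverse (lyapunovCLM n S)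

theorem spdForm_apply (S : SymMat n) (hS : S.mat.PosDef) (V W : SymMat n) :
    spdForm S V W = spdInner S hS V W := by
  rw [spdForm, ← coe_lyapunovEquiv S hS, ContinuousLinearMap.inverse_equiv, spdInner,
    ← tracePairing_lyapunovMap, lyapunovMap_lyapunov]
  rfl

/-- `S ↦ lyapunovCLM n S` is linear, and inversion of operators is smooth at an invertible one. -/
theorem contDiffAt_spdForm {S : SymMat n} (hS : S.mat.PosDef) :
    ContDiffAt ℝ ∞ (spdForm (n := n)) S := by
  have h1 : ContDiffAt ℝ ∞ (ContinuousLinearMap.inverse (R := ℝ) (M := SymMat n) (M₂ := SymMat n))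
      (lyapunovCLM n S) := by
    rw [← coe_lyapunovEquiv S hS]
    exact contDiffAt_map_inverse _
  have h2 : ContDiffAt ℝ ∞ (fun S => ContinuousLinearMap.inverse (lyapunovCLM n S)) S :=
    h1.comp S (lyapunovCLM n).contDiff.contDiffAt
  exact contDiffAt_const.clm_comp h2

theorem spdInner_comm (S : SymMat n) (hS : S.mat.PosDef) (V W : SymMat n) :
    spdInner S hS V W = spdInner S hS W V := by
  rw [spdInner, spdInner, ← Matrix.trace_transpose, Matrix.transpose_mul, Matrix.transpose_mul,
    mat_transpose, mat_transpose, mat_transpose, mul_assoc]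

theorem spdInner_self_nonneg (S : SymMat n) (hS : S.mat.PosDef) (V : SymMat n) :
    0 ≤ spdInner S hS V V := by
  have h := (hS.posSemidef.conjTranspose_mul_mul_same (lyapunov S hS V).mat).trace_nonneg
  rwa [Matrix.conjTranspose_eq_transpose_of_trivial, mat_transpose] at h

/-- A positive semidefinite `H S H` of trace zero vanishes; testing `S` on the columns of `H` then
gives `H = 0`, hence `V = 0`. -/
theorem spdInner_self_pos (S : SymMat n) (hS : S.mat.PosDef) {V : SymMat n} (hV : V ≠ 0) :
    0 < spdInner S hS V V := by
  refine (spdInner_self_nonneg S hS V).lt_of_ne fun h => hV ?_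
  set H := lyapunov S hS V with hH
  have hp := hS.posSemidef.conjTranspose_mul_mul_same H.mat
  rw [Matrix.conjTranspose_eq_transpose_of_trivial, mat_transpose] at hp
  have h0 : H.mat * S.mat * H.mat = 0 := hp.trace_eq_zero_iff.mp h.symm
  have h1 : tracePairing n H V = 0 := by
    rw [← lyapunovMap_lyapunov S hS V, tracePairing_lyapunovMap, ← hH, h0, Matrix.trace_zero]
  have hz : H.mat = 0 := by
    ext i j
    by_contra hij
    have hv : H.mat *ᵥ Pi.single j 1 ≠ 0 := fun h => hij (by simpa using congrFun h i)
    have hp := (Matrix.posDef_iff_dotProduct_mulVec.mp hS).2 hv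
    have ht : H.matᴴ = H.mat := by
      rw [Matrix.conjTranspose_eq_transpose_of_trivial, mat_transpose]
    rw [Matrix.star_mulVec, ht, ← Matrix.dotProduct_mulVec, Matrix.mulVec_mulVec,
      Matrix.mulVec_mulVec, h0] at hp
    simp at hp
  have hH0 : H = 0 := mat_injective hz
  rw [← lyapunovMap_lyapunov S hS V, ← hH, hH0, map_zero]

end Metric

/-! ### The product form on the model space -/

section Model

variable {m n : ℕ}

theorem posDef_cov (z : Z m n) : z.1.2.2.mat.PosDef := z.2

/-- The inner product of `ℝ^k` as a real bilinear form. -/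
noncomputable def innerForm (k : ℕ) :
    EuclideanSpace ℝ (Fin k) →L[ℝ] EuclideanSpace ℝ (Fin k) →L[ℝ] ℝ :=
  innerSL ℝ

/-- The component in `ℝ^m`. -/
noncomputable def featurePart (m n : ℕ) : Model m n →L[ℝ] EuclideanSpace ℝ (Fin m) :=
  ContinuousLinearMap.fst ℝ _ _

/-- The component in `ℝ^n`. -/
noncomputable def meanPart (m n : ℕ) : Model m n →L[ℝ] EuclideanSpace ℝ (Fin n) :=
  (ContinuousLinearMap.fst ℝ _ _).comp (ContinuousLinearMap.snd ℝ _ _)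

/-- The component in `S^n`. -/
noncomputable def covPart (m n : ℕ) : Model m n →L[ℝ] SymMat n :=
  (ContinuousLinearMap.snd ℝ _ _).comp (ContinuousLinearMap.snd ℝ _ _)

/-- The Riemannian metric of `Z` as a function of the point with values in bilinear forms. -/
noncomputable def zForm (z : Model m n) : Model m n →L[ℝ] Model m n →L[ℝ] ℝ :=
  ((innerForm m).bilinearComp (featurePart m n) (featurePart m n) +
    (innerForm n).bilinearComp (meanPart m n) (meanPart m n)) +
  (ContinuousLinearMap.precomp ℝ (covPart m n)).comp ((spdForm z.2.2).comp (covPart m n))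

theorem zInner_eq (z : Z m n) (hz : z.1.2.2.mat.PosDef) (u v : Model m n) : zInner z u v =
    inner ℝ u.1 v.1 + inner ℝ u.2.1 v.2.1 + spdInner z.1.2.2 hz u.2.2 v.2.2 := rfl

theorem zForm_apply (z : Z m n) (u v : Model m n) : zForm z.1 u v = zInner z u v := by
  rw [zInner_eq z (posDef_cov z), ← spdForm_apply]
  rfl

theorem contDiffAt_zForm (z : Z m n) : ContDiffAt ℝ ∞ (zForm (m := m) (n := n)) z.1 := by
  have h : ContDiffAt ℝ ∞ (fun z : Model m n => spdForm (covPart m n z)) z.1 :=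
    ContDiffAt.comp (g := spdForm (n := n)) (f := fun z : Model m n => covPart m n z) z.1
      (contDiffAt_spdForm (posDef_cov z)) (covPart m n).contDiff.contDiffAt
  exact contDiffAt_const.add (contDiffAt_const.clm_comp (h.clm_comp contDiffAt_const))

theorem zInner_comm (z : Z m n) (u v : Model m n) : zInner z u v = zInner z v u := by
  rw [zInner_eq z (posDef_cov z), zInner_eq z (posDef_cov z), real_inner_comm u.1, real_inner_comm u.2.1, spdInner_comm]

theorem zInner_self (z : Z m n) (hz : z.1.2.2.mat.PosDef) (u : Model m n) :
    zInner z u u = ‖u.1‖ ^ 2 + ‖u.2.1‖ ^ 2 + spdInner z.1.2.2 hz u.2.2 u.2.2 := by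
  rw [zInner_eq z hz, real_inner_self_eq_norm_sq, real_inner_self_eq_norm_sq]

theorem zInner_self_pos (z : Z m n) {u : Model m n} (hu : u ≠ 0) : 0 < zInner z u u := by
  have h0 := spdInner_self_nonneg z.1.2.2 (posDef_cov z) u.2.2
  rw [zInner_self z (posDef_cov z)]
  by_cases h1 : u.1 = 0
  · by_cases h2 : u.2.1 = 0
    · have h3 : u.2.2 ≠ 0 := fun h3 => hu (Prod.ext h1 (Prod.ext h2 h3))
      have := spdInner_self_pos z.1.2.2 (posDef_cov z) h3
      positivity
    · have : 0 < ‖u.2.1‖ := norm_pos_iff.mpr h2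
      positivity
  · have : 0 < ‖u.1‖ := norm_pos_iff.mpr h1
    positivity

end Model

/-! ### The Riemannian metric on the manifold and the length of paths -/

section Manifold

variable {m n : ℕ}

theorem mfderiv_coe_Z (z : Z m n) :
    mfderiv 𝓘(ℝ, Model m n) 𝓘(ℝ, Model m n) (fun y : Z m n => (y : Model m n)) z =
      ContinuousLinearMap.id ℝ (Model m n) := by
  have hd : MDifferentiableAt 𝓘(ℝ, Model m n) 𝓘(ℝ, Model m n)
      (fun y : Z m n => (y : Model m n)) z :=
    (contMDiff_subtype_val (n := 1)).mdifferentiableAt one_ne_zero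
  rw [hd.mfderiv]
  have h : writtenInExtChartAt 𝓘(ℝ, Model m n) 𝓘(ℝ, Model m n) z
      (fun y : Z m n => (y : Model m n)) =ᶠ[nhds (z : Model m n)] id := by
    have := TopologicalSpace.Opens.chartAt_subtype_val_symm_eventuallyEq (H := Model m n)
      (Z m n) (x := z)
    filter_upwards [this] with y hy
    exact hy.symm
  simp only [modelWithCornersSelf_coe, Set.range_id, fderivWithin_univ]
  exact (Filter.EventuallyEq.fderiv_eq h).trans fderiv_id

/-- All preferred charts of `Z` restrict the same identity chart, so every coordinate change is a
self-change. -/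
theorem coordChange_Z (y z z' : Z m n) :
    (tangentBundleCore 𝓘(ℝ, Model m n) (Z m n)).coordChange (achart (Model m n) z)
      (achart (Model m n) z') y = ContinuousLinearMap.id ℝ (Model m n) := by
  refine ContinuousLinearMap.ext fun v => ?_
  exact (tangentBundleCore 𝓘(ℝ, Model m n) (Z m n)).coordChange_self (achart (Model m n) z) y
    (mem_chart_source (Model m n) y) v

/-- By compactness the form has a positive lower bound `c` on the unit sphere of the model norm; by
homogeneity the set lies in the ball of radius `√c⁻¹`. -/
theorem isVonNBounded_zInner (z : Z m n) :
    Bornology.IsVonNBounded ℝ {v : Model m n | zInner z v v < 1} := by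
  have hc : Continuous fun v : Model m n => zForm z.1 v v :=
    (zForm z.1).continuous.clm_apply continuous_id
  obtain ⟨c, hc0, hc⟩ := (isCompact_sphere (0 : Model m n) 1).exists_forall_le' hc.continuousOn
    (a := 0) fun v hv => by
      rw [zForm_apply]
      exact zInner_self_pos z (ne_zero_of_mem_unit_sphere ⟨v, hv⟩)
  rw [NormedSpace.isVonNBounded_iff, isBounded_iff_forall_norm_le]
  refine ⟨√c⁻¹, fun v hv => Real.le_sqrt_of_sq_le ?_⟩
  rw [Set.mem_ofPred_eq, ← zForm_apply] at hv
  rcases eq_or_ne v 0 with rfl | h0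
  · simpa using hc0.le
  · have hn : 0 < ‖v‖ := norm_pos_iff.mpr h0
    have h1 := hc (‖v‖⁻¹ • v) (by simp [norm_smul, hn.ne'])
    rw [map_smul, map_smul, smul_apply, smul_eq_mul, smul_eq_mul] at h1
    rw [← one_div, le_div_iff₀ hc0]
    calc ‖v‖ ^ 2 * c ≤ ‖v‖ ^ 2 * (‖v‖⁻¹ * (‖v‖⁻¹ * zForm z.1 v v)) := by gcongr
      _ = zForm z.1 v v := by field_simp
      _ ≤ 1 := hv.le

/-- The Riemannian metric at a point of `Z` as a form on the tangent space. -/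
noncomputable def tangentForm (z : Z m n) : TangentSpace 𝓘(ℝ, Model m n) z →L[ℝ]
    TangentSpace 𝓘(ℝ, Model m n) z →L[ℝ] ℝ := zForm z.1

theorem contMDiff_tangentForm : ContMDiff 𝓘(ℝ, Model m n)
    (𝓘(ℝ, Model m n).prod 𝓘(ℝ, Model m n →L[ℝ] Model m n →L[ℝ] ℝ)) ∞
    (fun z : Z m n => TotalSpace.mk' (Model m n →L[ℝ] Model m n →L[ℝ] ℝ)
      (E := fun z : Z m n => TangentSpace 𝓘(ℝ, Model m n) z →L[ℝ]
        TangentSpace 𝓘(ℝ, Model m n) z →L[ℝ] ℝ) z (tangentForm z)) := by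
  intro z
  rw [contMDiffAt_section]
  have h : ContMDiffAt 𝓘(ℝ, Model m n) 𝓘(ℝ, Model m n →L[ℝ] Model m n →L[ℝ] ℝ) ∞
      (fun y : Z m n => zForm y.1) z :=
    ContMDiffAt.comp (g := zForm (m := m) (n := n)) (f := fun y : Z m n => y.1) z
      (contDiffAt_zForm z).contMDiffAt contMDiff_subtype_val.contMDiffAt
  refine h.congr_of_eventuallyEq (Filter.Eventually.of_forall fun y => ?_)
  refine ContinuousLinearMap.ext fun v => ContinuousLinearMap.ext fun w => ?_
  have := inCoordinates_apply_eq₂ (𝕜 := ℝ) (F₁ := Model m n) (F₂ := Model m n) (F₃ := ℝ)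
    (E₁ := fun z : Z m n => TangentSpace 𝓘(ℝ, Model m n) z)
    (E₂ := fun z : Z m n => TangentSpace 𝓘(ℝ, Model m n) z)
    (E₃ := Bundle.Trivial (Z m n) ℝ) (x₀ := z) (x := y) (ϕ := tangentForm y) (v := v) (w := w)
    (mem_chart_source (Model m n) y) (mem_chart_source (Model m n) y) (Set.mem_univ _)
  refine Eq.trans this ?_
  -- The local trivialization is the identity on fibres, so the section read in coordinates is
  -- `zForm` itself.
  have hs (v : Model m n) : (trivializationAt (Model m n)
      (fun z : Z m n => TangentSpace 𝓘(ℝ, Model m n) z) z).symm y v = v := by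
    refine ((tangentBundleCore 𝓘(ℝ, Model m n) (Z m n)).localTriv_symm_apply
      (achart (Model m n) z) (mem_chart_source (Model m n) y) v).trans ?_
    exact congrArg (fun f : Model m n →L[ℝ] Model m n => f v) (coordChange_Z y z y)
  rw [hs, hs]
  exact congrArg (fun f : ℝ →ₗ[ℝ] ℝ => f (zForm y.1 v w))
    (Bundle.Trivial.linearMapAt_trivialization ℝ (Z m n) ℝ y)


/-- The Riemannian metric of `Z`. -/
noncomputable def zMetric (m n : ℕ) : ContMDiffRiemannianMetric 𝓘(ℝ, Model m n) ∞ (Model m n)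
    (fun z : Z m n => TangentSpace 𝓘(ℝ, Model m n) z) where
  inner z := tangentForm z
  symm z v w := (zForm_apply z v w).trans ((zInner_comm z v w).trans (zForm_apply z w v).symm)
  pos z v hv := (zInner_self_pos z hv).trans_eq (zForm_apply z v v).symm
  isVonNBounded z := by
    have h := isVonNBounded_zInner z
    simp only [← zForm_apply] at h
    exact h
  contMDiff := contMDiff_tangentForm

/-- The Riemannian structure on the tangent bundle of `Z`. -/
noncomputable abbrev riemannianBundleZ (m n : ℕ) : RiemannianBundle
    (fun z : Z m n => TangentSpace 𝓘(ℝ, Model m n) z) := ⟨(zMetric m n).toRiemannianMetric⟩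

attribute [local instance] riemannianBundleZ

theorem enorm_tangentSpace_Z (z : Z m n) (v : TangentSpace 𝓘(ℝ, Model m n) z) :
    ‖v‖ₑ = ENNReal.ofReal (√(zInner z v v)) := by
  rw [← ofReal_norm, norm_eq_sqrt_real_inner]
  exact congrArg (fun x => ENNReal.ofReal √x) (zForm_apply z v v)

/-- The velocity of a path in `Z` is the derivative of the underlying path of vectors. -/
theorem mfderivWithin_Z {γ : ℝ → Z m n} {s : Set ℝ} {t : ℝ} (hs : UniqueDiffWithinAt ℝ s t)
    (hγ : MDifferentiableWithinAt 𝓘(ℝ, ℝ) 𝓘(ℝ, Model m n) γ s t) :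
    mfderivWithin 𝓘(ℝ, ℝ) 𝓘(ℝ, Model m n) γ s t (1 : ℝ) =
      derivWithin (fun t => (γ t : Model m n)) s t := by
  have hd : MDifferentiableAt 𝓘(ℝ, Model m n) 𝓘(ℝ, Model m n)
      (fun y : Z m n => (y : Model m n)) (γ t) :=
    (contMDiff_subtype_val (n := 1)).mdifferentiableAt one_ne_zero
  have h := mfderiv_comp_mfderivWithin t hd hγ hs.uniqueMDiffWithinAt
  rw [mfderiv_coe_Z, mfderivWithin_eq_fderivWithin] at h
  rw [← fderivWithin_derivWithin]
  exact (congrArg (fun f : ℝ →L[ℝ] Model m n => f 1) h).symm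

theorem pathELength_Z {γ : ℝ → Z m n} (hγ : ContMDiffOn 𝓘(ℝ, ℝ) 𝓘(ℝ, Model m n) 1 γ (Set.Icc 0 1)) :
    pathELength 𝓘(ℝ, Model m n) γ 0 1 = ∫⁻ t in Set.Icc (0 : ℝ) 1, ENNReal.ofReal
      (√(zInner (γ t) (derivWithin (fun t => (γ t : Model m n)) (Set.Icc 0 1) t)
        (derivWithin (fun t => (γ t : Model m n)) (Set.Icc 0 1) t))) := by
  rw [pathELength_eq_lintegral_mfderivWithin_Icc]
  refine MeasureTheory.setLIntegral_congr_fun measurableSet_Icc fun t ht => ?_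
  rw [enorm_tangentSpace_Z]
  have h := mfderivWithin_Z (uniqueDiffOn_Icc one_pos t ht)
    (hγ.mdifferentiableOn one_ne_zero t ht)
  exact congrArg (fun v : Model m n => ENNReal.ofReal (√(zInner (γ t) v v))) h

end Manifold

/-! ### Upper bound: displacement interpolation -/

section UpperBound

variable {m n : ℕ}

attribute [local instance] riemannianBundleZ

theorem spdInner_self_of_lyapunovMap_eq {S H V : SymMat n} (hS : S.mat.PosDef)
    (h : lyapunovMap S H = V) : spdInner S hS V V = (H.mat * S.mat * H.mat).trace := by
  rw [spdInner, ← h, lyapunov_lyapunovMap]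

/-- A curve of constant speed `L` in `Z`, given as a curve of vectors, bounds the distance of its
endpoints. -/
theorem riemannianEDist_le_of_curve {c c' : ℝ → Model m n} {L : ℝ}
    (hc : ContDiff ℝ 1 c) (hmem : ∀ t ∈ Set.Icc (0 : ℝ) 1, c t ∈ Z m n)
    (hd : ∀ t, HasDerivAt c (c' t) t)
    (hL : ∀ t (ht : t ∈ Set.Icc (0 : ℝ) 1), √(zInner ⟨c t, hmem t ht⟩ (c' t) (c' t)) = L)
    (z₁ z₂ : Z m n) (h0 : c 0 = z₁) (h1 : c 1 = z₂) :
    riemannianEDist 𝓘(ℝ, Model m n) z₁ z₂ ≤ ENNReal.ofReal L := by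
  classical
  -- Off `[0, 1]` the curve may leave `Z`; the value there is irrelevant.
  let γ : ℝ → Z m n := fun t => if h : c t ∈ Z m n then ⟨c t, h⟩ else z₁
  have hγ : ∀ t (ht : t ∈ Set.Icc (0 : ℝ) 1), γ t = ⟨c t, hmem t ht⟩ := fun t ht =>
    dif_pos (hmem t ht)
  have hval : Set.EqOn (fun t => (γ t : Model m n)) c (Set.Icc 0 1) := fun t ht =>
    congrArg Subtype.val (hγ t ht)
  have hsm : ContMDiffOn 𝓘(ℝ, ℝ) 𝓘(ℝ, Model m n) 1 γ (Set.Icc 0 1) := fun t ht =>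
    (ChartedSpace.liftPropWithinAt_subtypeVal_comp_iff ..).mp
      ((hc.contMDiff.contMDiffOn.congr hval) t ht)
  have hle := riemannianEDist_le_pathELength hsm (x := z₁) (y := z₂)
    (Subtype.ext ((hval (Set.left_mem_Icc.mpr zero_le_one)).trans h0))
    (Subtype.ext ((hval (Set.right_mem_Icc.mpr zero_le_one)).trans h1)) zero_le_one
  rw [pathELength_Z hsm] at hle
  refine hle.trans_eq ?_
  have hint : ∀ t ∈ Set.Icc (0 : ℝ) 1, ENNReal.ofReal
      (√(zInner (γ t) (derivWithin (fun t => (γ t : Model m n)) (Set.Icc 0 1) t)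
        (derivWithin (fun t => (γ t : Model m n)) (Set.Icc 0 1) t))) = ENNReal.ofReal L := by
    intro t ht
    rw [derivWithin_congr hval (hval ht),
      (hd t).hasDerivWithinAt.derivWithin (uniqueDiffOn_Icc one_pos t ht), hγ t ht, hL t ht]
  rw [MeasureTheory.setLIntegral_congr_fun measurableSet_Icc hint]
  simp

/-- The symmetric matrix `D S D`. -/
def symConj (S D : SymMat n) : SymMat n :=
  ⟨D.mat * S.mat * D.mat, by
    change (D.mat * S.mat * D.mat)ᵀ = _
    rw [Matrix.transpose_mul, Matrix.transpose_mul, mat_transpose, mat_transpose, mul_assoc]⟩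

theorem mat_symConj (S D : SymMat n) : (symConj S D).mat = D.mat * S.mat * D.mat := rfl

/-- The displacement interpolation `(1 + t D) S (1 + t D)`. -/
noncomputable def displacement (S D : SymMat n) (t : ℝ) : SymMat n :=
  S + t • lyapunovMap S D + t ^ 2 • symConj S D

theorem mat_displacement (S D : SymMat n) (t : ℝ) :
    (displacement S D t).mat = (1 + t • D.mat) * S.mat * (1 + t • D.mat) := by
  simp only [displacement, mat_add, mat_smul, mat_lyapunovMap, mat_symConj, add_mul, mul_add,
    one_mul, mul_one, smul_mul_assoc, mul_smul_comm, smul_add, sq, mul_smul]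
  abel

theorem hasDerivAt_displacement (S D : SymMat n) (t : ℝ) :
    HasDerivAt (displacement S D) (lyapunovMap S D + (2 * t) • symConj S D) t := by
  have h1 : HasDerivAt (fun t : ℝ => t • lyapunovMap S D) (lyapunovMap S D) t := by
    simpa using (hasDerivAt_id t).smul_const (lyapunovMap S D)
  have h2 : HasDerivAt (fun t : ℝ => t ^ 2 • symConj S D) ((2 * t) • symConj S D) t := by
    simpa using (hasDerivAt_pow 2 t).smul_const (symConj S D)
  exact (h1.const_add S).add h2

theorem contDiff_displacement (S D : SymMat n) : ContDiff ℝ 1 (displacement S D) := by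
  unfold displacement
  fun_prop

/-- The displacement interpolation has constant speed. -/
theorem spdInner_displacement {S D : SymMat n} {t : ℝ} (hM : (1 + t • D.mat).PosDef)
    (hS : (displacement S D t).mat.PosDef) :
    spdInner (displacement S D t) hS (lyapunovMap S D + (2 * t) • symConj S D)
      (lyapunovMap S D + (2 * t) • symConj S D) = (D.mat * S.mat * D.mat).trace := by
  have hmat := mat_displacement S D t
  set M := 1 + t • D.mat with hMdef
  have hu := (Matrix.isUnit_iff_isUnit_det M).mp hM.isUnit
  have h1 : M⁻¹ * M = 1 := Matrix.nonsing_inv_mul _ hu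
  have h2 : M * M⁻¹ = 1 := Matrix.mul_nonsing_inv _ hu
  have hcomm : M * D.mat = D.mat * M := by
    simp [hMdef, add_mul, mul_add]
  have hcomm' : M⁻¹ * D.mat = D.mat * M⁻¹ := by
    calc M⁻¹ * D.mat = M⁻¹ * (D.mat * M) * M⁻¹ := by rw [mul_assoc, mul_assoc, h2, mul_one]
      _ = D.mat * M⁻¹ := by rw [← hcomm, ← mul_assoc, h1, one_mul]
  -- The velocity of `M S M` is `D S M + M S D`, so the Lyapunov equation is solved by any `H` with
  -- `H M = M H = D`; symmetry holds since `M` and `D` commute.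
  let H : SymMat n := ⟨M⁻¹ * D.mat, by
    change (M⁻¹ * D.mat)ᵀ = _
    rw [Matrix.transpose_mul, transpose_eq_of_posDef hM.inv, mat_transpose, hcomm']⟩
  have hH : H.mat = M⁻¹ * D.mat := rfl
  have hH' : H.mat = D.mat * M⁻¹ := hcomm'
  have hHM : H.mat * M = D.mat := by rw [hH', mul_assoc, h1, mul_one]
  have hMH : M * H.mat = D.mat := by rw [hH, ← mul_assoc, h2, one_mul]
  have hl : lyapunovMap (displacement S D t) H = lyapunovMap S D + (2 * t) • symConj S D := by
    apply mat_injective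
    rw [mat_lyapunovMap, hmat, mat_add, mat_lyapunovMap, mat_smul, mat_symConj]
    calc H.mat * (M * S.mat * M) + M * S.mat * M * H.mat
        = (H.mat * M) * S.mat * M + M * S.mat * (M * H.mat) := by noncomm_ring
      _ = D.mat * S.mat * M + M * S.mat * D.mat := by rw [hHM, hMH]
      _ = _ := by
        rw [hMdef]
        simp only [mul_add, add_mul, mul_one, one_mul, smul_mul_assoc, mul_smul_comm, two_mul,
          add_smul]
        abel
  rw [spdInner_self_of_lyapunovMap_eq hS hl, hmat]
  congr 1
  calc H.mat * (M * S.mat * M) * H.mat = (H.mat * M) * S.mat * (M * H.mat) := by noncomm_ring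
    _ = _ := by rw [hHM, hMH]

theorem posDef_one_add_smul {T : Matrix (Fin n) (Fin n) ℝ} (hT : T.PosDef) {t : ℝ}
    (ht : t ∈ Set.Icc (0 : ℝ) 1) : (1 + t • (T - 1)).PosDef := by
  have h : 1 + t • (T - 1) = (1 - t) • (1 : Matrix (Fin n) (Fin n) ℝ) + t • T := by
    rw [smul_sub, sub_smul, one_smul]; abel
  rw [h]
  rcases ht.2.eq_or_lt with h1 | h1
  · rw [h1]; simpa using hT
  · exact (Matrix.PosDef.one.smul (sub_pos.mpr h1)).add_posSemidef (hT.posSemidef.smul ht.1)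

theorem riemannianEDist_le_zDist (z₁ z₂ : Z m n) :
    riemannianEDist 𝓘(ℝ, Model m n) z₁ z₂ ≤ ENNReal.ofReal (zDist z₁ z₂) := by
  obtain ⟨T, hT, hTB, htr⟩ := exists_transport_bures (posDef_cov z₁) (posDef_cov z₂)
  set S := z₁.1.2.2
  let D : SymMat n := ⟨T - 1, by
    change (T - 1)ᵀ = _
    rw [Matrix.transpose_sub, transpose_eq_of_posDef hT, Matrix.transpose_one]⟩
  have hD : D.mat = T - 1 := rfl
  have hM : ∀ t ∈ Set.Icc (0 : ℝ) 1, (1 + t • D.mat).PosDef := fun t ht =>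
    posDef_one_add_smul hT ht
  have hpos : ∀ t ∈ Set.Icc (0 : ℝ) 1, (displacement S D t).mat.PosDef := fun t ht => by
    rw [mat_displacement]
    exact posDef_mul_mul (posDef_cov z₁) (hM t ht)
  let w := z₂.1.1 - z₁.1.1
  let v := z₂.1.2.1 - z₁.1.2.1
  let c : ℝ → Model m n := fun t => (z₁.1.1 + t • w, z₁.1.2.1 + t • v, displacement S D t)
  let c' : ℝ → Model m n := fun t => (w, v, lyapunovMap S D + (2 * t) • symConj S D)
  have hc : ContDiff ℝ 1 c := by
    have := contDiff_displacement S D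
    fun_prop
  have hd : ∀ t, HasDerivAt c (c' t) t := fun t => by
    have h1 : HasDerivAt (fun t : ℝ => z₁.1.1 + t • w) w t := by
      simpa using ((hasDerivAt_id t).smul_const w).const_add z₁.1.1
    have h2 : HasDerivAt (fun t : ℝ => z₁.1.2.1 + t • v) v t := by
      simpa using ((hasDerivAt_id t).smul_const v).const_add z₁.1.2.1
    exact h1.prodMk (h2.prodMk (hasDerivAt_displacement S D t))
  refine riemannianEDist_le_of_curve (c := c) (c' := c') hc hpos hd (fun t ht => ?_) z₁ z₂ ?_ ?_
  · rw [zInner_self _ (hpos t ht), zDist]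
    have h3 := spdInner_displacement (hM t ht) (hpos t ht)
    rw [hD, htr] at h3
    rw [← h3, norm_sub_rev z₁.1.1, norm_sub_rev z₁.1.2.1]
  · refine Prod.ext ?_ (Prod.ext ?_ ?_)
    · simp [c]
    · simp [c]
    · simp [c, displacement, S]
  · refine Prod.ext ?_ (Prod.ext ?_ ?_)
    · simp [c, w]
    · simp [c, v]
    · apply mat_injective
      rw [← hTB]
      change (displacement S D 1).mat = _
      rw [mat_displacement, one_smul, hD, add_sub_cancel]

end UpperBound

/-! ### Lower bound: comparing `zDist` with the length of a path -/

section LowerBound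

variable {m n : ℕ}

open Filter Topology Set

theorem zDist_comm (z₁ z₂ : Z m n) : zDist z₁ z₂ = zDist z₂ z₁ := by
  rw [zDist, zDist, norm_sub_rev, norm_sub_rev z₁.1.2.1, bures_comm (posDef_cov z₁) (posDef_cov z₂)]

theorem bures_self {A : Matrix (Fin n) (Fin n) ℝ} (hA : A.PosDef) : bures A A = 0 := by
  have h := bures_sq_le hA hA (T := 1) Matrix.transpose_one (by simp)
  rw [sub_self, zero_mul, zero_mul, Matrix.trace_zero] at h
  exact pow_eq_zero_iff two_ne_zero |>.mp (le_antisymm h (sq_nonneg _))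

theorem zDist_self (z : Z m n) : zDist z z = 0 := by
  simp [zDist, bures_self (posDef_cov z)]

/-- Minkowski's inequality for three coordinates. -/
theorem sqrt_sum_sq_add_le (a b c a' b' c' : ℝ) :
    √((a + a') ^ 2 + (b + b') ^ 2 + (c + c') ^ 2) ≤
      √(a ^ 2 + b ^ 2 + c ^ 2) + √(a' ^ 2 + b' ^ 2 + c' ^ 2) := by
  simpa [EuclideanSpace.norm_eq, Fin.sum_univ_three] using norm_add_le !₂[a, b, c] !₂[a', b', c']

theorem zDist_triangle (z₁ z₂ z₃ : Z m n) : zDist z₁ z₃ ≤ zDist z₁ z₂ + zDist z₂ z₃ := by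
  refine le_trans (Real.sqrt_le_sqrt ?_) (sqrt_sum_sq_add_le _ _ _ _ _ _)
  have h := bures_triangle (posDef_cov z₁) (posDef_cov z₂) (posDef_cov z₃)
  have h0 := bures_nonneg z₁.1.2.2.mat z₃.1.2.2.mat
  have h1 := norm_sub_le_norm_sub_add_norm_sub z₁.1.1 z₂.1.1 z₃.1.1
  have h2 := norm_sub_le_norm_sub_add_norm_sub z₁.1.2.1 z₂.1.2.1 z₃.1.2.1
  gcongr

/-- The bilinear map `(D, E) ↦ (D S E + E S D) / 2`. -/
noncomputable def symProd (S : SymMat n) : SymMat n →L[ℝ] SymMat n →L[ℝ] SymMat n :=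
  LinearMap.toContinuousBilinearMap
    (LinearMap.mk₂ ℝ (fun D E => ⟨(1 / 2 : ℝ) • (D.mat * S.mat * E.mat + E.mat * S.mat * D.mat), by
        change ((1 / 2 : ℝ) • (D.mat * S.mat * E.mat + E.mat * S.mat * D.mat))ᵀ = _
        simp only [Matrix.transpose_smul, Matrix.transpose_add, Matrix.transpose_mul,
          mat_transpose, mul_assoc]
        rw [add_comm]⟩)
      (fun A B C => mat_injective <| by
        change (1 / 2 : ℝ) • ((A.mat + B.mat) * S.mat * C.mat + C.mat * S.mat * (A.mat + B.mat)) =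
          (1 / 2 : ℝ) • (A.mat * S.mat * C.mat + C.mat * S.mat * A.mat) +
            (1 / 2 : ℝ) • (B.mat * S.mat * C.mat + C.mat * S.mat * B.mat)
        rw [← smul_add]; congr 1; noncomm_ring)
      (fun c A B => mat_injective <| by
        change (1 / 2 : ℝ) • ((c • A.mat) * S.mat * B.mat + B.mat * S.mat * (c • A.mat)) =
          c • ((1 / 2 : ℝ) • (A.mat * S.mat * B.mat + B.mat * S.mat * A.mat))
        rw [smul_comm c]; simp [smul_add])
      (fun C A B => mat_injective <| by
        change (1 / 2 : ℝ) • (C.mat * S.mat * (A.mat + B.mat) + (A.mat + B.mat) * S.mat * C.mat) =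
          (1 / 2 : ℝ) • (C.mat * S.mat * A.mat + A.mat * S.mat * C.mat) +
            (1 / 2 : ℝ) • (C.mat * S.mat * B.mat + B.mat * S.mat * C.mat)
        rw [← smul_add]; congr 1; noncomm_ring)
      (fun c A B => mat_injective <| by
        change (1 / 2 : ℝ) • (A.mat * S.mat * (c • B.mat) + (c • B.mat) * S.mat * A.mat) =
          c • ((1 / 2 : ℝ) • (A.mat * S.mat * B.mat + B.mat * S.mat * A.mat))
        rw [smul_comm c]; simp [smul_add]))

theorem symProd_self (S D : SymMat n) : symProd S D D = symConj S D := by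
  apply mat_injective
  change (1 / 2 : ℝ) • (D.mat * S.mat * D.mat + D.mat * S.mat * D.mat) = D.mat * S.mat * D.mat
  rw [← two_smul ℝ, smul_smul]
  norm_num

/-- Near a positive definite `S`, every symmetric matrix is `(1 + D) S (1 + D)` for a symmetric `D`
whose derivative at `S` is the Lyapunov operator. -/
theorem exists_local_transport (S : SymMat n) (hS : S.mat.PosDef) :
    ∃ σ : SymMat n → SymMat n, σ S = 0 ∧
      HasFDerivAt σ ((lyapunovEquiv S hS).symm : SymMat n →L[ℝ] SymMat n) S ∧
      ∀ᶠ B in 𝓝 S, displacement S (σ B) 1 = B := by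
  -- The map is `D ↦ S + L D + D S D`, with `L` the Lyapunov operator; the quadratic term has zero
  -- derivative at `0`.
  have hG : HasStrictFDerivAt (fun D => displacement S D 1)
      (lyapunovEquiv S hS : SymMat n →L[ℝ] SymMat n) 0 := by
    have h1 : HasStrictFDerivAt (fun D : SymMat n => S + lyapunovCLM n S D) (lyapunovCLM n S) 0 :=
      (lyapunovCLM n S).hasStrictFDerivAt.const_add S
    have h2 := (symProd S).hasStrictFDerivAt_of_bilinear
      (hasStrictFDerivAt_id (𝕜 := ℝ) (0 : SymMat n)) (hasStrictFDerivAt_id (0 : SymMat n))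
    have h3 := h1.add h2
    convert h3 using 1
    · ext1 D
      simp [displacement, symProd_self, lyapunovCLM_apply]
    · refine ContinuousLinearMap.ext fun v => ?_
      rw [coe_lyapunovEquiv, add_apply, add_apply]
      change _ = _ + (symProd S 0 v + symProd S v 0)
      rw [map_zero, map_zero, zero_apply, add_zero, add_zero]
  have h0 : displacement S (0 : SymMat n) 1 = S := by
    apply mat_injective
    rw [mat_displacement, mat_zero]
    simp
  refine ⟨hG.localInverse _ _ _, ?_, ?_, ?_⟩
  · have := hG.localInverse_apply_image
    rwa [h0] at this
  · have := hG.to_localInverse.hasFDerivAt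
    rwa [h0] at this
  · have := hG.eventually_right_inverse
    rwa [h0] at this

/-- Locally the distance is bounded by the norm of the tangent space in a chart whose derivative at
the base point is the identity. -/
theorem exists_chart_zDist_le (z : Z m n) : ∃ ψ : Model m n → Model m n, ψ z = 0 ∧
    HasFDerivAt ψ (ContinuousLinearMap.id ℝ (Model m n)) z ∧
    ∀ᶠ y in 𝓝 (z : Model m n), ∀ hy : y ∈ Z m n,
      zDist z ⟨y, hy⟩ ≤ √(zForm z.1 (ψ y) (ψ y)) := by
  set S := z.1.2.2 with hSdef
  have hS : S.mat.PosDef := posDef_cov z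
  obtain ⟨σ, hσ0, hσ, hloc⟩ := exists_local_transport S hS
  -- Applying the Lyapunov operator after `σ` makes the derivative the identity and turns the metric
  -- norm of the last component into `tr (σ S σ)`, the bound given by `bures_sq_le` for `T = 1 + σ`.
  refine ⟨fun y => (y.1 - z.1.1, y.2.1 - z.1.2.1, lyapunovCLM n S (σ y.2.2)), ?_, ?_, ?_⟩
  · change (z.1.1 - z.1.1, z.1.2.1 - z.1.2.1, lyapunovCLM n S (σ S)) = 0
    rw [hσ0, map_zero, sub_self, sub_self]
    rfl
  · have h1 : HasFDerivAt (fun y : Model m n => y.1 - z.1.1) (featurePart m n) z.1 :=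
      (featurePart m n).hasFDerivAt.sub_const _
    have h2 : HasFDerivAt (fun y : Model m n => y.2.1 - z.1.2.1) (meanPart m n) z.1 :=
      (meanPart m n).hasFDerivAt.sub_const _
    have h3 : HasFDerivAt (fun y : Model m n => lyapunovCLM n S (σ y.2.2)) (covPart m n) z.1 := by
      have h4 : HasFDerivAt (fun B => lyapunovCLM n S (σ B))
          (ContinuousLinearMap.id ℝ (SymMat n)) S := by
        have h5 := (lyapunovCLM n S).hasFDerivAt.comp S hσ
        rw [← coe_lyapunovEquiv S hS, ContinuousLinearEquiv.coe_comp_coe_symm] at h5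
        exact h5
      exact HasFDerivAt.comp (g := fun B => lyapunovCLM n S (σ B)) z.1 h4
        (covPart m n).hasFDerivAt
    exact h1.prodMk (h2.prodMk h3)
  · have htend : Tendsto (fun y : Model m n => y.2.2) (𝓝 z.1) (𝓝 S) :=
      (covPart m n).continuous.continuousAt
    filter_upwards [htend.eventually hloc] with y hy hyZ
    rw [zForm_apply, zInner_self z hS, zDist]
    refine Real.sqrt_le_sqrt (add_le_add (by rw [norm_sub_rev z.1.1, norm_sub_rev z.1.2.1]) ?_)
    rw [spdInner_self_of_lyapunovMap_eq hS (lyapunovCLM_apply S _).symm]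
    have hB : (1 + (σ y.2.2).mat) * S.mat * (1 + (σ y.2.2).mat) = y.2.2.mat := by
      have := congrArg SymMat.mat hy
      rwa [mat_displacement, one_smul] at this
    have := bures_sq_le hS (B := y.2.2.mat) hyZ (T := 1 + (σ y.2.2).mat)
      (by rw [Matrix.transpose_add, mat_transpose, Matrix.transpose_one]) hB
    rwa [add_sub_cancel_left] at this

/-- The distance of the endpoints of a curve in `Z` is at most its length. -/
theorem zDist_le_integral {γ : ℝ → Z m n} {d : ℝ → Model m n}
    (hd : ∀ t ∈ Icc (0 : ℝ) 1,
      HasDerivWithinAt (fun t => (γ t : Model m n)) (d t) (Icc 0 1) t)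
    (hcont : ContinuousOn (fun t => √(zForm (γ t).1 (d t) (d t))) (Icc 0 1)) :
    zDist (γ 0) (γ 1) ≤ ∫ t in Icc (0 : ℝ) 1, √(zForm (γ t).1 (d t) (d t)) := by
  set N : ℝ → ℝ := fun t => √(zForm (γ t).1 (d t) (d t)) with hN
  set e : ℝ → Model m n := fun t => (γ t : Model m n) with he
  have hform (z : Z m n) : Continuous fun u : Model m n => √(zForm z.1 u u) :=
    ((zForm z.1).continuous.clm_apply continuous_id).sqrt
  have hcontf : ContinuousOn (fun t => zDist (γ 0) (γ t)) (Icc 0 1) := by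
    intro t ht
    obtain ⟨ψ, hψ0, hψ, hloc⟩ := exists_chart_zDist_le (γ t)
    have hec : Tendsto e (𝓝[Icc 0 1] t) (𝓝 (e t)) := (hd t ht).continuousWithinAt
    have hlim : Tendsto (fun s => √(zForm (γ t).1 (ψ (e s)) (ψ (e s)))) (𝓝[Icc 0 1] t) (𝓝 0) := by
      have h1 := ((hform (γ t)).tendsto _).comp (hψ.continuousAt.tendsto.comp hec)
      rw [hψ0, map_zero, Real.sqrt_zero] at h1
      exact h1
    refine tendsto_iff_dist_tendsto_zero.mpr
      (squeeze_zero' (Eventually.of_forall fun _ => dist_nonneg) ?_ hlim)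
    filter_upwards [hec.eventually hloc] with s hs
    have h1 := hs (γ s).2
    have h2 := zDist_triangle (γ 0) (γ t) (γ s)
    have h3 := zDist_triangle (γ 0) (γ s) (γ t)
    rw [zDist_comm (γ s)] at h3
    have h4 : |zDist (γ 0) (γ s) - zDist (γ 0) (γ t)| ≤ zDist (γ t) (γ s) :=
      abs_le.mpr ⟨by linarith, by linarith⟩
    exact h4.trans h1
  -- Extending the speed continuously to `ℝ` makes its primitive differentiable at every point,
  -- endpoints included.
  let N' : ℝ → ℝ := IccExtend zero_le_one ((Icc (0 : ℝ) 1).domRestrict N)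
  have hN'c : Continuous N' := hcont.domRestrict.Icc_extend'
  have hN'eq : ∀ t ∈ Icc (0 : ℝ) 1, N' t = N t := fun t ht => IccExtend_of_mem _ _ ht
  have hB : ∀ t, HasDerivAt (fun u => ∫ s in (0 : ℝ)..u, N' s) (N' t) t := fun t =>
    (hN'c.integral_hasStrictDerivAt 0 t).hasDerivAt
  have hmain := image_le_of_liminf_slope_right_le_deriv_boundary hcontf
    (B := fun u => ∫ s in (0 : ℝ)..u, N' s) (B' := N') (by simp [zDist_self])
    (fun t _ => (hB t).continuousAt.continuousWithinAt)
    (fun t _ => (hB t).hasDerivWithinAt) ?_ (right_mem_Icc.mpr zero_le_one)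
  · refine hmain.trans_eq ?_
    rw [intervalIntegral.integral_of_le zero_le_one, MeasureTheory.integral_Icc_eq_integral_Ioc]
    exact MeasureTheory.setIntegral_congr_fun measurableSet_Ioc
      fun t ht => hN'eq t (Ioc_subset_Icc_self ht)
  · intro t ht r hr
    have ht' := Ico_subset_Icc_self ht
    rw [hN'eq t ht'] at hr
    obtain ⟨ψ, hψ0, hψ, hloc⟩ := exists_chart_zDist_le (γ t)
    have hdt : HasDerivWithinAt e (d t) (Ioi t) t :=
      (hd t ht').mono_of_mem_nhdsWithin (mem_of_superset (Ioo_mem_nhdsGT ht.2)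
        fun s hs => ⟨ht.1.trans hs.1.le, hs.2.le⟩)
    have hψd : HasDerivWithinAt (fun s => ψ (e s)) (d t) (Ioi t) t :=
      HasFDerivAt.comp_hasDerivWithinAt (l := ψ) (f := e) t hψ hdt
    have hslope : Tendsto (fun s => (s - t)⁻¹ • ψ (e s)) (𝓝[>] t) (𝓝 (d t)) := by
      have h1 := (hasDerivWithinAt_iff_tendsto_slope' (self_notMem_Ioi)).mp hψd
      have h2 : ψ (e t) = 0 := hψ0
      simpa only [slope_fun_def, vsub_eq_sub, h2, sub_zero] using h1
    have hlim := ((hform (γ t)).tendsto _).comp hslope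
    have hec : Tendsto e (𝓝[>] t) (𝓝 (e t)) := hdt.continuousWithinAt
    -- By the triangle inequality the slope is at most `zDist (γ t) (γ s) / (s - t)`, hence at most
    -- the metric norm at `γ t` of `(s - t)⁻¹ • ψ (e s)`, which tends to the speed at `t`.
    refine Eventually.frequently ?_
    filter_upwards [hlim.eventually (gt_mem_nhds hr), hec.eventually hloc, self_mem_nhdsWithin]
      with s hs hs' hts
    have hpos : 0 < (s - t)⁻¹ := inv_pos.mpr (sub_pos.mpr hts)
    refine lt_of_le_of_lt ?_ hs
    have h1 := hs' (γ s).2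
    have h2 := zDist_triangle (γ 0) (γ t) (γ s)
    have h3 : √(zForm (γ t).1 ((s - t)⁻¹ • ψ (e s)) ((s - t)⁻¹ • ψ (e s))) =
        (s - t)⁻¹ * √(zForm (γ t).1 (ψ (e s)) (ψ (e s))) := by
      rw [map_smul, map_smul, smul_apply, smul_eq_mul, smul_eq_mul, ← mul_assoc,
        Real.sqrt_mul (by positivity), Real.sqrt_mul_self hpos.le]
    rw [Function.comp_apply, h3, slope_def_field, div_eq_inv_mul]
    exact mul_le_mul_of_nonneg_left (by linarith) hpos.le

attribute [local instance] riemannianBundleZ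

theorem zDist_le_riemannianEDist (z₁ z₂ : Z m n) :
    ENNReal.ofReal (zDist z₁ z₂) ≤ riemannianEDist 𝓘(ℝ, Model m n) z₁ z₂ := by
  refine le_of_forall_gt fun r hr => ?_
  obtain ⟨γ, h0, h1, hγ, hlen⟩ := exists_lt_of_riemannianEDist_lt hr
  refine lt_of_le_of_lt ?_ hlen
  rw [pathELength_Z hγ]
  set e : ℝ → Model m n := fun t => (γ t : Model m n) with he
  have hed : ContDiffOn ℝ 1 e (Icc 0 1) :=
    ((contMDiff_subtype_val (n := 1)).comp_contMDiffOn hγ).contDiffOn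
  have hdc : ContinuousOn (derivWithin e (Icc 0 1)) (Icc 0 1) :=
    hed.continuousOn_derivWithin (uniqueDiffOn_Icc one_pos) le_rfl
  have hcont : ContinuousOn (fun t => √(zForm (γ t).1 (derivWithin e (Icc 0 1) t)
      (derivWithin e (Icc 0 1) t))) (Icc 0 1) := by
    have hf : ContinuousOn (fun t => zForm (e t)) (Icc 0 1) := fun t ht =>
      ContinuousAt.comp_continuousWithinAt (f := e) (contDiffAt_zForm (γ t)).continuousAt
        (hed.continuousOn t ht)
    exact ((hf.clm_apply hdc).clm_apply hdc).sqrt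
  have hle := zDist_le_integral
    (fun t ht => (hed.differentiableOn one_ne_zero t ht).hasDerivWithinAt) hcont
  rw [h0, h1] at hle
  refine (ENNReal.ofReal_le_ofReal hle).trans_eq ?_
  rw [MeasureTheory.ofReal_integral_eq_lintegral_ofReal
    (hcont.integrableOn_compact isCompact_Icc) (Eventually.of_forall fun _ => Real.sqrt_nonneg _)]
  simp only [zForm_apply]

end LowerBound

end FeatureGaussian

theorem mainTheorem5 (m n : ℕ) :
    IsManifold 𝓘(ℝ, FeatureGaussian.Model m n) ∞ (FeatureGaussian.Z m n) ∧
    (∀ z : FeatureGaussian.Z m n,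
      mfderiv 𝓘(ℝ, FeatureGaussian.Model m n) 𝓘(ℝ, FeatureGaussian.Model m n)
        (fun y : FeatureGaussian.Z m n => (y : FeatureGaussian.Model m n)) z =
      ContinuousLinearMap.id ℝ (FeatureGaussian.Model m n)) ∧
    ∃ g : ContMDiffRiemannianMetric 𝓘(ℝ, FeatureGaussian.Model m n) ∞
        (FeatureGaussian.Model m n)
        (fun z : FeatureGaussian.Z m n =>
          TangentSpace 𝓘(ℝ, FeatureGaussian.Model m n) z),
      (∀ (z : FeatureGaussian.Z m n) (u₁ u₂ : FeatureGaussian.Model m n),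
        g.inner z u₁ u₂ = FeatureGaussian.zInner z u₁ u₂) ∧
      (letI : RiemannianBundle (fun z : FeatureGaussian.Z m n =>
          TangentSpace 𝓘(ℝ, FeatureGaussian.Model m n) z) := ⟨g.toRiemannianMetric⟩
       ∀ z₁ z₂ : FeatureGaussian.Z m n,
        riemannianEDist 𝓘(ℝ, FeatureGaussian.Model m n) z₁ z₂ =
          ENNReal.ofReal (FeatureGaussian.zDist z₁ z₂)) := by
  refine ⟨inferInstance, FeatureGaussian.mfderiv_coe_Z, FeatureGaussian.zMetric m n,
    FeatureGaussian.zForm_apply, fun z₁ z₂ => le_antisymm ?_ ?_⟩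
  · exact FeatureGaussian.riemannianEDist_le_zDist z₁ z₂
  · exact FeatureGaussian.zDist_le_riemannianEDist z₁ z₂
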